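/- Let $\mathcal X\subseteq\mathbb R^n$ be path-connected with $0\in\mathcal X$, let $\mathcal U\subseteq\mathbb R^m$, and let $f,\hat f:\mathcal X\to\mathbb R^n$ and $g,\hat g:\mathcal X\to\mathbb R^{n\times m}$ be Lipschitz continuous. Put $A=g-\hat g$ and $\mathbf b=f-\hat f$. Consider the system $$\dot x=f(x)+g(x)u=\hat f(x)+\hat g(x)u+A(x)u+\mathbf b(x),$$ and its estimated model $\dot x=\hat f(x)+\hat g(x)u$. Class $\mathcal K_\infty$ consists of the continuous strictly increasing $\alpha:[0,\infty)\to[0,\infty)$ with $\alpha(0)=0$ and $\alpha(r)\to\infty$ as $r\to\infty$. Class $\mathcal{KL}_\infty$ consists of the continuous $\beta:[0,\infty)^2\to[0,\infty)$ such that $\beta(\cdot,s)\in\mathcal K_\infty$ for every $s$, and $\beta(r,\cdot)$ is nonincreasing with limit $0$ for every $r$. Let $\mathcal C\subseteq\mathcal X$ with $0\in\mathcal C$, and let the continuously differentiable function $V:\mathcal X\to[0,\infty)$ be a control Lyapunov function for the estimated model on $\mathcal C$: there are $\underline\alpha,\overline\alpha,\alpha\in\mathcal K_\infty$ such that, for all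 $x\in\mathcal C$, $$\underline\alpha(\|x\|)\le V(x)\le\overline\alpha(\|x\|),\qquad \inf_{u\in\mathcal U}\nabla V(x)^\top\bigl(\hat f(x)+\hat g(x)u\bigr)\le-\alpha(\|x\|).$$ Let $\hat a:\mathcal X\to\mathbb R^m$ and $\hat b:\mathcal X\to\mathbb R$ be continuous estimators ($\hat a=0$, $\hat b=0$ is allowed), and put $$\hat{\dot V}(x,u)=\nabla V(x)^\top(\hat f(x)+\hat g(x)u)+\hat a(x)^\top u+\hat b(x),$$ $$a(x)=A(x)^\top\nabla V(x)-\hat a(x),\qquad b(x)=\mathbf b(x)^\top\nabla V(x)-\hat b(x).$$ Let $k:\mathcal X\to\mathcal U$ be a state-feedback controller with $\hat{\dot V}(x,k(x))\le-\alpha(\|x\|)$ for all $x\in\mathcal C$. Let $\delta(x)=a(x)^\top k(x)+b(x)$ be the projected disturbance. Let $\Delta$ be an uncertainty function, that is, for each $x\in\mathcal X$ the set $\Delta(x)\subseteq\mathbb R^m\times\mathbb R$ is bounded and contains $(a(x),b(x))$. Let $\alpha_p,\alpha_q\in\mathcal K_\infty$ satisfy $\alpha_p+\alpha_q=\alpha$.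 Write $B_r$ for the open ball of radius $r$ around $0$ in $\mathbb R^n$ ($B_0=\emptyset$). Suppose that $\mathcal E\subseteq\mathcal X$ and $\mu\ge0$ satisfy $$\sup_{(a,b)\in\Delta(x)}\bigl(a^\top k(x)+b\bigr)\le\mu\qquad\text{for all }x\in\mathcal E,$$ and that, for some $c>0$, the sublevel set $\Omega=\{x\in\mathcal X:V(x)\le c\}$ satisfies $$B_{\alpha_q^{-1}(\mu)}\subseteq\Omega\subseteq\mathcal C\cap\mathcal E.$$ Then the closed-loop system $\dot x=f(x)+g(x)k(x)$ is projection to state stable (PSS) with respect to $V$ on $\Omega$: every solution in $\mathcal X$ starting in $\Omega$ stays in $\Omega$, and there are $\beta\in\mathcal{KL}_\infty$, $\gamma\in\mathcal K_\infty$ such that every solution with $x(0)\in\Omega$ satisfies $$\|x(t)\|\le\beta(\|x(0)\|,t)+\gamma\Bigl(\sup_{\tau}|\delta(x(\tau))|\Bigr)$$ for all times $t\ge0$ at which it is defined, where $\tau$ ranges over the time interval of the solution (and the bound is void if the supremum is infinite). In addition, among the sublevel sets $\{x\in\mathcal X:V(x)\le c'\}$, $c'\ge0$, that contain $B_{\alpha_q^{-1}(\mu)}$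 there is a smallest one, $S$. If $\Omega$ is closed in $\mathbb R^n$ (which is automatic if $\mathcal X$ is closed), then $S$ is asymptotically stable with respect to initial states in $\Omega$: $\emptyset\neq S\subseteq\Omega$; solutions starting in $S$ stay in $S$; for every $\varepsilon>0$ there is $\eta>0$ such that every solution with $x(0)\in\Omega$ and $\operatorname{dist}(x(0),S)<\eta$ satisfies $\operatorname{dist}(x(t),S)<\varepsilon$ as long as it is defined; and $\operatorname{dist}(x(t),S)\to0$ as $t\to\infty$ for every solution on $[0,\infty)$ with $x(0)\in\Omega$. Moreover, if $S\ne\Omega$, then $\Omega$ contains all states in $\mathcal X$ within some positive distance of $S$. -/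

import Mathlib

open Set Filter Topology
open scoped NNReal RealInnerProductSpace

noncomputable section

/-- Real `n`-dimensional space with its Euclidean norm. -/
abbrev Vec (n : ℕ) := EuclideanSpace ℝ (Fin n)

/-! ### Comparison functions -/

/-- Class `K∞`: continuous, strictly increasing, zero at zero and unbounded on `[0, ∞)`. -/
structure ClassKInf (α : ℝ≥0 → ℝ≥0) : Prop where
  continuous : Continuous α
  strictMono : StrictMono α
  map_zero : α 0 = 0
  tendsto : Tendsto α atTop atTop

/-- Class `KL∞`: jointly continuous, of class `K∞` in the first variable, and nonincreasing with
limit zero in the second one. -/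
structure ClassKLInf (β : ℝ≥0 → ℝ≥0 → ℝ≥0) : Prop where
  continuous : Continuous (Function.uncurry β)
  kInf : ∀ s, ClassKInf (fun r => β r s)
  antitone : ∀ r, Antitone (β r)
  tendsto : ∀ r, Tendsto (β r) atTop (𝓝 0)

/-- The inverse of a comparison function. -/
def kInv (α : ℝ≥0 → ℝ≥0) : ℝ≥0 → ℝ≥0 := Function.invFun α

theorem ClassKInf.surjective {α : ℝ≥0 → ℝ≥0} (h : ClassKInf α) : Function.Surjective α := by
  intro y
  obtain ⟨R, hR⟩ := (h.tendsto.eventually_ge_atTop y).exists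
  have hy : y ∈ Icc (α 0) (α R) := ⟨by simp [h.map_zero], hR⟩
  obtain ⟨x, -, hx⟩ := intermediate_value_Icc (zero_le : (0 : ℝ≥0) ≤ R)
    h.continuous.continuousOn hy
  exact ⟨x, hx⟩

/-- On a class `K∞` function, `kInv` is a genuine two-sided inverse. -/
theorem ClassKInf.apply_kInv {α : ℝ≥0 → ℝ≥0} (h : ClassKInf α) (r : ℝ≥0) :
    α (kInv α r) = r := Function.rightInverse_invFun h.surjective r

theorem ClassKInf.kInv_apply {α : ℝ≥0 → ℝ≥0} (h : ClassKInf α) (r : ℝ≥0) :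
    kInv α (α r) = r := Function.leftInverse_invFun h.strictMono.injective r

/-! ### The uncertain control-affine system -/

/-- A control-affine system `x' = f x + g x u` together with an estimated model
`x' = fhat x + ghat x u`, on a path-connected state space `X` containing the origin and with the
set `U` of control inputs. The (actuation) matrices are linear maps with the operator norm. All
maps only matter on `X`. -/
structure UncertainSystem (n m : ℕ) where
  X : Set (Vec n)
  U : Set (Vec m)
  f : Vec n → Vec n
  g : Vec n → Vec m →L[ℝ] Vec n
  fhat : Vec n → Vec n
  ghat : Vec n → Vec m →L[ℝ] Vec n
  pathConnected : IsPathConnected X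
  zero_mem : 0 ∈ X
  f_lipschitz : ∃ K, LipschitzOnWith K f X
  g_lipschitz : ∃ K, LipschitzOnWith K g X
  fhat_lipschitz : ∃ K, LipschitzOnWith K fhat X
  ghat_lipschitz : ∃ K, LipschitzOnWith K ghat X

namespace UncertainSystem

variable {n m : ℕ} (sys : UncertainSystem n m)

/-- Actuation error. -/
def A (x : Vec n) : Vec m →L[ℝ] Vec n := sys.g x - sys.ghat x

/-- Drift error. -/
def b (x : Vec n) : Vec n := sys.f x - sys.fhat x

/-- The estimated model with the disturbance `d = A x u + b x`, in closed loop with the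
state-feedback controller `k`. -/
def closedLoop (k : Vec n → Vec m) (x : Vec n) : Vec n :=
  sys.fhat x + sys.ghat x (k x) + (sys.A x (k x) + sys.b x)

/-- Derivative along the estimated model of a function with gradient `gradV`. -/
def nominalDeriv (gradV : Vec n → Vec n) (x : Vec n) (u : Vec m) : ℝ :=
  ⟪sys.fhat x + sys.ghat x u, gradV x⟫

/-- Estimated time derivative, corrected by the estimators `ahat` and `bhat`
(the uncorrected one is the case `ahat = 0`, `bhat = 0`). -/
def estDeriv (gradV : Vec n → Vec n) (ahat : Vec n → Vec m) (bhat : Vec n → ℝ)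
    (x : Vec n) (u : Vec m) : ℝ :=
  sys.nominalDeriv gradV x u + ⟪ahat x, u⟫ + bhat x

/-- Residual coefficient of the input in the time derivative. -/
def resA (gradV : Vec n → Vec n) (ahat : Vec n → Vec m) (x : Vec n) : Vec m :=
  ContinuousLinearMap.adjoint (sys.A x) (gradV x) - ahat x

/-- Residual drift term in the time derivative. -/
def resB (gradV : Vec n → Vec n) (bhat : Vec n → ℝ) (x : Vec n) : ℝ :=
  ⟪sys.b x, gradV x⟫ - bhat x

/-- The projected disturbance `δ = aᵀ u + b` at the state `x`, under the controller `k`. -/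
def projDist (gradV : Vec n → Vec n) (ahat : Vec n → Vec m) (bhat : Vec n → ℝ)
    (k : Vec n → Vec m) (x : Vec n) : ℝ :=
  ⟪sys.resA gradV ahat x, k x⟫ + sys.resB gradV bhat x

/-- `V` is a nonnegative continuously differentiable function on `X`, with gradient `gradV`. -/
structure IsC1With (V : Vec n → ℝ) (gradV : Vec n → Vec n) : Prop where
  nonneg : ∀ x ∈ sys.X, 0 ≤ V x
  hasGradient : ∀ x ∈ sys.X, HasGradientWithinAt V (gradV x) sys.X x
  continuousOn : ContinuousOn gradV sys.X

/-- `V` is a control Lyapunov function on `C ⊆ X` for the estimated model, with comparison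
functions `αl`, `αu`, `α`. The infimum is taken in the extended reals. -/
structure IsCLFOn (V : Vec n → ℝ) (gradV : Vec n → Vec n) (αl αu α : ℝ≥0 → ℝ≥0)
    (C : Set (Vec n)) : Prop where
  c1 : sys.IsC1With V gradV
  lower_kInf : ClassKInf αl
  upper_kInf : ClassKInf αu
  decay_kInf : ClassKInf α
  lower : ∀ x ∈ C, (αl ‖x‖₊ : ℝ) ≤ V x
  upper : ∀ x ∈ C, V x ≤ αu ‖x‖₊
  decay : ∀ x ∈ C,
    (⨅ u ∈ sys.U, ((sys.nominalDeriv gradV x u : ℝ) : EReal)) ≤ ((-(α ‖x‖₊ : ℝ) : ℝ) : EReal)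

/-- Admissible inputs at `x`. -/
def admissible (gradV : Vec n → Vec n) (ahat : Vec n → Vec m) (bhat : Vec n → ℝ)
    (α : ℝ≥0 → ℝ≥0) (x : Vec n) : Set (Vec m) :=
  {u | u ∈ sys.U ∧ sys.estDeriv gradV ahat bhat x u ≤ -(α ‖x‖₊ : ℝ)}

/-- `Δ` is an uncertainty function: bounded sets containing the true residuals. -/
def IsUncertaintyFunction (gradV : Vec n → Vec n) (ahat : Vec n → Vec m) (bhat : Vec n → ℝ)
    (Δ : Vec n → Set (Vec m × ℝ)) : Prop :=
  ∀ x ∈ sys.X, Bornology.IsBounded (Δ x) ∧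
    (sys.resA gradV ahat x, sys.resB gradV bhat x) ∈ Δ x

end UncertainSystem

/-- The worst-case projected disturbance `sup_{(a, b) ∈ Δ} (aᵀ u + b)` over the set `Δ`. -/
def worstCase {m : ℕ} (Δ : Set (Vec m × ℝ)) (u : Vec m) : ℝ :=
  sSup ((fun p : Vec m × ℝ => ⟪p.1, u⟫ + p.2) '' Δ)

/-- The sublevel set of `V : X → ℝ` at level `c`. -/
def sublevelSet {n : ℕ} (X : Set (Vec n)) (V : Vec n → ℝ) (c : ℝ) : Set (Vec n) :=
  {x | x ∈ X ∧ V x ≤ c}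

/-! ### Solutions and stability -/

/-- `x` is a solution of `x' = F x` with values in `X` on the time interval `J`, which starts at
time `0` (for instance `[0, ∞)`, `[0, T)` or `[0, T]`). -/
structure IsSolutionOn {n : ℕ} (X : Set (Vec n)) (F : Vec n → Vec n) (J : Set ℝ)
    (x : ℝ → Vec n) : Prop where
  zero_mem : 0 ∈ J
  nonneg : J ⊆ Ici 0
  ordConnected : J.OrdConnected
  mapsTo : MapsTo x J X
  integralCurve : IsIntegralCurveOn x (fun _ => F) J

/-- Every solution of `x' = F x` that starts in `S` remains in `S`. -/
def IsFwdInvariant {n : ℕ} (X : Set (Vec n)) (F : Vec n → Vec n) (S : Set (Vec n)) : Prop :=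
  ∀ (J : Set ℝ) (x : ℝ → Vec n), IsSolutionOn X F J x → x 0 ∈ S → ∀ t ∈ J, x t ∈ S

/-- Projection to state stability of `x' = F x` on `Ω`, where `δ x` is the projected
disturbance at the state `x`: the set `Ω` is forward invariant, and
`‖x t‖ ≤ β (‖x 0‖, t) + γ (sup_τ |δ (x τ)|)` for the solutions starting in `Ω` (along which the
projected disturbance is bounded; otherwise the supremum is infinite). -/
def IsPSSOn {n : ℕ} (X : Set (Vec n)) (F : Vec n → Vec n) (δ : Vec n → ℝ)
    (Ω : Set (Vec n)) : Prop :=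
  IsFwdInvariant X F Ω ∧
  ∃ (β : ℝ≥0 → ℝ≥0 → ℝ≥0) (γ : ℝ≥0 → ℝ≥0), ClassKLInf β ∧ ClassKInf γ ∧
    ∀ (J : Set ℝ) (x : ℝ → Vec n), IsSolutionOn X F J x → x 0 ∈ Ω →
      BddAbove ((fun τ => ‖δ (x τ)‖₊) '' J) →
      ∀ t ∈ J, ‖x t‖₊ ≤ β ‖x 0‖₊ t.toNNReal + γ (sSup ((fun τ => ‖δ (x τ)‖₊) '' J))

/-- Asymptotic stability of the set `S` for `x' = F x` with initial states in `Ω`: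
invariance, (Lyapunov) stability, and attraction of all solutions from `Ω`. -/
structure IsAsymptoticallyStableOn {n : ℕ} (X : Set (Vec n)) (F : Vec n → Vec n)
    (Ω S : Set (Vec n)) : Prop where
  nonempty : S.Nonempty
  subset : S ⊆ Ω
  invariant : IsFwdInvariant X F S
  stable : ∀ ε > 0, ∃ η > 0, ∀ (J : Set ℝ) (x : ℝ → Vec n), IsSolutionOn X F J x → x 0 ∈ Ω →
    Metric.infDist (x 0) S < η → ∀ t ∈ J, Metric.infDist (x t) S < ε
  attractive : ∀ x : ℝ → Vec n, IsSolutionOn X F (Ici 0) x → x 0 ∈ Ω →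
    Tendsto (fun t => Metric.infDist (x t) S) atTop (𝓝 0)

end

noncomputable section

/-! ### Comparison functions -/

namespace ClassKInf

variable {α β : ℝ≥0 → ℝ≥0}

/-! Along closed-loop solutions `V` changes at the rate `estDeriv + projDist` (`inner_closedLoop`),
so on `Ω` its derivative is at most `-α(‖x‖) + δ(x)`. Everything follows from this inequality. Since
`δ ≤ μ` on `Ω`, and `μ ≤ αq(‖x‖)` outside the ball `B` of radius `kInv αq μ`, the derivative there
is at most `-αp(‖x‖)`. A solution therefore cannot leave a sublevel set that contains `B` and has
level in `(0, c]`: a boundary point lies in the open set `B`, or `V` strictly decreases there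
(`isFwdInvariant_sublevelSet`). For PSS, `V ≤ αu(‖x‖)` turns the inequality into `w' ≤ -ρ(w) + d`
for `w = V` along a solution, with `ρ = α ∘ kInv αu`; `le_decayBound_or_le` bounds such `w` without
solving a comparison equation. The level of `S` is the supremum of `V` over `B` and `0`. Every shell
between `S` and `Ω` avoids `B`, so `V` falls there at a uniform rate, and compactness of `Ω`
converts levels of `V` into distances (`isAsymptoticallyStableOn_sublevelSet`). -/

theorem comp (hα : ClassKInf α) (hβ : ClassKInf β) : ClassKInf (fun r => α (β r)) where
  continuous := hα.continuous.comp hβ.continuous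
  strictMono := hα.strictMono.comp hβ.strictMono
  map_zero := by rw [hβ.map_zero, hα.map_zero]
  tendsto := hα.tendsto.comp hβ.tendsto

theorem le_kInv_iff (hα : ClassKInf α) {r s : ℝ≥0} : r ≤ kInv α s ↔ α r ≤ s := by
  conv_rhs => rw [← hα.apply_kInv s]
  exact hα.strictMono.le_iff_le.symm

theorem kInv_le_iff (hα : ClassKInf α) {r s : ℝ≥0} : kInv α s ≤ r ↔ s ≤ α r := by
  conv_rhs => rw [← hα.apply_kInv s]
  exact hα.strictMono.le_iff_le.symm

theorem lt_kInv_iff (hα : ClassKInf α) {r s : ℝ≥0} : r < kInv α s ↔ α r < s := by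
  rw [← not_le, hα.kInv_le_iff, not_le]

theorem kInv_lt_iff (hα : ClassKInf α) {r s : ℝ≥0} : kInv α s < r ↔ s < α r := by
  rw [← not_le, hα.le_kInv_iff, not_le]

theorem pos (hα : ClassKInf α) {r : ℝ≥0} (hr : 0 < r) : 0 < α r := by
  rw [← hα.map_zero]
  exact hα.strictMono hr

protected theorem kInv (hα : ClassKInf α) : ClassKInf (kInv α) := by
  have hm : StrictMono (kInv α) := fun a b hab => by
    rwa [hα.lt_kInv_iff, hα.apply_kInv]
  have hs : Function.Surjective (kInv α) := fun r => ⟨α r, hα.kInv_apply r⟩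
  refine ⟨hm.monotone.continuous_of_surjective hs, hm, ?_, ?_⟩
  · rw [← hα.map_zero, hα.kInv_apply]
    exact hα.map_zero.symm
  · exact tendsto_atTop.2 fun r => by
      filter_upwards [eventually_ge_atTop (α r)] with s hs
      exact hα.le_kInv_iff.2 hs

theorem id_add_mul (hα : ClassKInf α) (t : ℝ≥0) : ClassKInf (fun w => w + t * α w) where
  continuous := by have := hα.continuous; fun_prop
  strictMono := fun a b hab =>
    add_lt_add_of_lt_of_le hab (mul_le_mul_right (hα.strictMono hab).le t)
  map_zero := by simp [hα.map_zero]
  tendsto := tendsto_atTop_mono (fun w => le_self_add) tendsto_id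

end ClassKInf

/-- An explicit decay estimate: `w = decayBound ρ r t` is the solution of `w + (t / 2) ρ w = r`. -/
def decayBound (ρ : ℝ≥0 → ℝ≥0) (r t : ℝ≥0) : ℝ≥0 := kInv (fun w => w + t / 2 * ρ w) r

theorem le_decayBound_iff {ρ : ℝ≥0 → ℝ≥0} (hρ : ClassKInf ρ) {r t w : ℝ≥0} :
    w ≤ decayBound ρ r t ↔ w + t / 2 * ρ w ≤ r :=
  (hρ.id_add_mul (t / 2)).le_kInv_iff

theorem decayBound_le_iff {ρ : ℝ≥0 → ℝ≥0} (hρ : ClassKInf ρ) {r t w : ℝ≥0} :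
    decayBound ρ r t ≤ w ↔ r ≤ w + t / 2 * ρ w :=
  (hρ.id_add_mul (t / 2)).kInv_le_iff

/-- Joint continuity needs no estimate: comparing the implicitly defined value with a fixed `a`
amounts to a strict inequality between continuous functions of `(r, t)`. -/
theorem classKLInf_decayBound {ρ : ℝ≥0 → ℝ≥0} (hρ : ClassKInf ρ) :
    ClassKLInf (decayBound ρ) where
  continuous := by
    rw [OrderTopology.continuous_iff]
    intro a
    constructor
    · have : Function.uncurry (decayBound ρ) ⁻¹' Ioi a = {p | a + p.2 / 2 * ρ a < p.1} := by
        ext p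
        simp only [mem_preimage, Function.uncurry, mem_Ioi, mem_ofPred_eq]
        rw [← not_le, decayBound_le_iff hρ, not_le]
      rw [this]
      exact isOpen_lt (by fun_prop) (by fun_prop)
    · have : Function.uncurry (decayBound ρ) ⁻¹' Iio a = {p | p.1 < a + p.2 / 2 * ρ a} := by
        ext p
        simp only [mem_preimage, Function.uncurry, mem_Iio, mem_ofPred_eq]
        rw [← not_le, le_decayBound_iff hρ, not_le]
      rw [this]
      exact isOpen_lt (by fun_prop) (by fun_prop)
  kInf := fun s => (hρ.id_add_mul (s / 2)).kInv
  antitone := fun r s t hst => by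
    rw [le_decayBound_iff hρ]
    refine le_trans ?_ ((le_decayBound_iff hρ).1 (le_refl (decayBound ρ r t)))
    gcongr
  tendsto := fun r => by
    rw [tendsto_order]
    refine ⟨fun a ha => absurd ha not_lt_zero, fun a ha => ?_⟩
    have hpos := hρ.pos ha
    filter_upwards [eventually_ge_atTop (2 * (r / ρ a))] with t ht
    rw [← not_le, le_decayBound_iff hρ, not_le]
    have h1 : r ≤ t / 2 * ρ a := by
      rw [← div_le_iff₀ hpos, le_div_iff₀ (by norm_num), mul_comm]
      exact ht
    exact lt_of_le_of_lt h1 (lt_add_of_pos_left _ ha)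

theorem ClassKLInf.comp {β : ℝ≥0 → ℝ≥0 → ℝ≥0} {α₁ α₂ : ℝ≥0 → ℝ≥0} (hβ : ClassKLInf β)
    (h₁ : ClassKInf α₁) (h₂ : ClassKInf α₂) : ClassKLInf (fun r t => α₁ (β (α₂ r) t)) where
  continuous := h₁.continuous.comp
    (hβ.continuous.comp ((h₂.continuous.comp continuous_fst).prodMk continuous_snd))
  kInf := fun s => h₁.comp ((hβ.kInf s).comp h₂)
  antitone := fun r _ _ hst => h₁.strictMono.monotone (hβ.antitone _ hst)
  tendsto := fun r => by
    have := (h₁.continuous.tendsto 0).comp (hβ.tendsto (α₂ r))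
    rwa [h₁.map_zero] at this

/-! ### Scalar differential inequalities -/

theorem HasDerivWithinAt.Ici_of_Icc {w : ℝ → ℝ} {d a b s : ℝ}
    (h : HasDerivWithinAt w d (Icc a b) s) (hs : s ∈ Ico a b) :
    HasDerivWithinAt w d (Ici s) s :=
  h.mono_of_mem_nhdsWithin (Icc_mem_nhdsGE_of_mem hs)

/-- A function whose derivative is at most `-q` decreases at least at the rate `q`. -/
theorem le_sub_mul_of_deriv_le {w w' : ℝ → ℝ} {a b q : ℝ} (hab : a ≤ b)
    (hw : ∀ s ∈ Icc a b, HasDerivWithinAt w (w' s) (Icc a b) s)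
    (hq : ∀ s ∈ Icc a b, w' s ≤ -q) : w b ≤ w a - q * (b - a) := by
  have hB : ∀ s, HasDerivAt (fun s => w a - q * (s - a)) (-q) s := fun s => by
    simpa using (((hasDerivAt_id s).sub_const a).const_mul q).const_sub (w a)
  exact image_le_of_deriv_right_le_deriv_boundary
    (fun s hs => (hw s hs).continuousWithinAt)
    (fun s hs => (hw s (Ico_subset_Icc_self hs)).Ici_of_Icc hs) (by simp)
    (fun s _ => (hB s).continuousAt.continuousWithinAt)
    (fun s _ => (hB s).hasDerivWithinAt)
    (fun s hs => hq s (Ico_subset_Icc_self hs)) (right_mem_Icc.2 hab)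

/-- Input-to-state estimate for `w' ≤ -ρ w + d`: either `w` has decayed according to `decayBound`
or it is below the ultimate bound. -/
theorem le_decayBound_or_le {ρ : ℝ≥0 → ℝ≥0} (hρ : ClassKInf ρ) {w : ℝ → ℝ≥0} {w' : ℝ → ℝ}
    {d t : ℝ≥0}
    (hw : ∀ s ∈ Icc (0 : ℝ) t, HasDerivWithinAt (fun s => (w s : ℝ)) (w' s) (Icc 0 t) s)
    (hd : ∀ s ∈ Icc (0 : ℝ) t, w' s ≤ -(ρ (w s) : ℝ) + d) :
    w t ≤ decayBound ρ (w 0) t ∨ ρ (w t) ≤ 2 * d := by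
  by_contra! hcon
  obtain ⟨h1, h2⟩ := hcon
  apply h1.not_ge
  -- A level `c` with `w s < c < w t` and `ρ c > 2 * d` is a barrier: wherever `w = c`, the
  -- derivative is negative, so `w` could not climb from `w s` to `w t`.
  have hge : ∀ s ∈ Icc (0 : ℝ) t, w t ≤ w s := by
    intro s hs
    by_contra! hlt
    obtain ⟨c, hc1, hc2⟩ := exists_between (max_lt hlt (hρ.kInv_lt_iff.2 h2))
    have hsub : Icc s (t : ℝ) ⊆ Icc 0 t := Icc_subset_Icc_left hs.1
    have := image_le_of_deriv_right_lt_deriv_boundary (f := fun s => (w s : ℝ)) (f' := w')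
      (B := fun _ => (c : ℝ)) (B' := fun _ => 0) (a := s) (b := t)
      (fun r hr => ((hw r (hsub hr)).continuousWithinAt).mono hsub)
      (fun r hr => ((hw r (hsub (Ico_subset_Icc_self hr))).mono hsub).Ici_of_Icc hr)
      (NNReal.coe_le_coe.2 ((le_max_left _ _).trans hc1.le))
      (fun r => hasDerivAt_const r _)
      (fun r hr hrc => by
        have h3 := hd r (hsub (Ico_subset_Icc_self hr))
        rw [NNReal.coe_inj.1 hrc] at h3
        have h4 : 2 * d < ρ c := hρ.kInv_lt_iff.1 ((le_max_right _ _).trans_lt hc1)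
        have h5 : 2 * (d : ℝ) < ρ c := by exact_mod_cast h4
        have h6 := d.coe_nonneg
        linarith) (right_mem_Icc.2 hs.2)
    exact absurd (NNReal.coe_le_coe.1 this) hc2.not_ge
  rw [le_decayBound_iff hρ, ← NNReal.coe_le_coe]
  -- Half of `ρ (w t)` absorbs `d`, the other half is the decay rate; this is the source of `t / 2`
  -- in `decayBound`.
  have := le_sub_mul_of_deriv_le (q := (ρ (w t) : ℝ) / 2) t.coe_nonneg hw (fun s hs => by
    have h3 := hd s hs
    have h4 : (ρ (w t) : ℝ) ≤ ρ (w s) :=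
      NNReal.coe_le_coe.2 (hρ.strictMono.monotone (hge s hs))
    have h5 : 2 * (d : ℝ) < ρ (w t) := by exact_mod_cast h2
    linarith)
  push_cast
  linarith

/-! ### Lyapunov functions along solutions -/

section Lyapunov

variable {n : ℕ} {X : Set (Vec n)} {F : Vec n → Vec n} {V D : Vec n → ℝ}

/-- `D` is the derivative of `V` along the solutions of `x' = F x` in `X`. -/
def IsOrbitalDeriv (X : Set (Vec n)) (F : Vec n → Vec n) (V D : Vec n → ℝ) : Prop :=
  ∀ (J : Set ℝ) (x : ℝ → Vec n), IsSolutionOn X F J x →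
    ∀ t ∈ J, HasDerivWithinAt (fun s => V (x s)) (D (x t)) J t

theorem IsSolutionOn.Icc_subset {J : Set ℝ} {x : ℝ → Vec n} (h : IsSolutionOn X F J x) {t : ℝ}
    (ht : t ∈ J) : Icc 0 t ⊆ J := h.ordConnected.out h.zero_mem ht

theorem sublevelSet_mono {c c' : ℝ} (h : c ≤ c') : sublevelSet X V c ⊆ sublevelSet X V c' :=
  fun _ hx => ⟨hx.1, hx.2.trans h⟩

/-- A sublevel set is invariant if `V` decreases strictly on its boundary, except possibly at
interior points of it. -/
theorem isFwdInvariant_sublevelSet (hD : IsOrbitalDeriv X F V D) {c : ℝ} {O : Set (Vec n)}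
    (hO : IsOpen O) (hOc : O ⊆ sublevelSet X V c)
    (hneg : ∀ y ∈ X, V y = c → y ∉ O → D y < 0) :
    IsFwdInvariant X F (sublevelSet X V c) := by
  intro J x hx h0 t ht
  refine ⟨hx.mapsTo ht, ?_⟩
  have hsub := hx.Icc_subset ht
  have hderiv : ∀ s ∈ Icc 0 t, HasDerivWithinAt (fun s => V (x s)) (D (x s)) (Icc 0 t) s :=
    fun s hs => (hD J x hx s (hsub hs)).mono hsub
  have hcont : ContinuousOn (fun s => V (x s)) (Icc 0 t) :=
    fun s hs => (hderiv s hs).continuousWithinAt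
  have hclosed : IsClosed ({s | V (x s) ≤ c} ∩ Icc 0 t) := by
    rw [inter_comm]
    exact hcont.preimage_isClosed_of_isClosed isClosed_Icc isClosed_Iic
  -- Continuous induction in time: the good times form a closed set, so it suffices to continue a
  -- little to the right of each.
  refine hclosed.Icc_subset_of_forall_mem_nhdsWithin h0.2 ?_ (right_mem_Icc.2 (hx.nonneg ht))
  rintro s ⟨hsc, hs⟩
  have hsI := Ico_subset_Icc_self hs
  have hle : 𝓝[>] s ≤ 𝓝[Icc 0 t] s :=
    nhdsWithin_le_iff.2 (Icc_mem_nhdsGT_of_mem hs)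
  rcases lt_or_eq_of_le (show V (x s) ≤ c from hsc) with hlt | heq
  · filter_upwards [hle ((hcont s hsI).eventually (gt_mem_nhds hlt))] with r hr
    exact le_of_lt hr
  by_cases hsO : x s ∈ O
  · have hxc : ContinuousWithinAt x (Icc 0 t) s :=
      ((hx.integralCurve s (hsub hsI)).continuousWithinAt).mono hsub
    filter_upwards [hle (hxc.eventually (hO.mem_nhds hsO))] with r hr
    exact (hOc hr).2
  · have hd := ((hderiv s hsI).Ici_of_Icc hs).mono Ioi_subset_Ici_self
    rw [hasDerivWithinAt_iff_tendsto_slope' self_notMem_Ioi] at hd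
    filter_upwards [hd.eventually (gt_mem_nhds (hneg _ (hx.mapsTo (hsub hsI)) heq hsO)),
      self_mem_nhdsWithin] with r hr hsr
    rw [slope_def_field, div_neg_iff] at hr
    have hpos : 0 < r - s := sub_pos.2 hsr
    show V (x r) ≤ c
    rcases hr with hr | hr <;> linarith [hr.1, hr.2]

/-- Compact sublevel sets are asymptotically stable on a larger one when `V` decreases at a
positive rate on each shell between them. -/
theorem isAsymptoticallyStableOn_sublevelSet (hV : ContinuousOn V X) (hD : IsOrbitalDeriv X F V D)
    {c₀ c : ℝ} (hc : c₀ ≤ c) (hcpt : IsCompact (sublevelSet X V c))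
    (hne : (sublevelSet X V c₀).Nonempty) (hinvc : IsFwdInvariant X F (sublevelSet X V c))
    (hinv : ∀ c', c₀ < c' → c' ≤ c → IsFwdInvariant X F (sublevelSet X V c'))
    (hdecay : ∀ c', c₀ < c' → c' ≤ c → ∃ q > 0, ∀ y ∈ X, c' ≤ V y → V y ≤ c → D y ≤ -q) :
    IsAsymptoticallyStableOn X F (sublevelSet X V c) (sublevelSet X V c₀) ∧
    (sublevelSet X V c₀ ≠ sublevelSet X V c →
      ∃ η > 0, Metric.thickening η (sublevelSet X V c₀) ∩ X ⊆ sublevelSet X V c) := by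
  set S := sublevelSet X V c₀ with hS
  have hSΩ : S ⊆ sublevelSet X V c := sublevelSet_mono hc
  have hVΩ : ContinuousOn V (sublevelSet X V c) := hV.mono fun y hy => hy.1
  rcases hc.eq_or_lt with rfl | hlt
  · have h0 : ∀ y ∈ S, Metric.infDist y S = 0 := fun y hy => Metric.infDist_zero_of_mem hy
    refine ⟨⟨hne, hSΩ, hinvc, fun ε hε => ⟨1, one_pos, ?_⟩, ?_⟩, fun h => absurd rfl h⟩
    · intro J x hx hx0 _ t ht
      rwa [h0 _ (hinvc J x hx hx0 t ht)]
    · intro x hx hx0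
      refine tendsto_const_nhds.congr' ?_
      filter_upwards [eventually_ge_atTop 0] with t ht
      rw [h0 _ (hinvc _ x hx hx0 t ht)]
  have hScpt : IsCompact S := by
    have : S = sublevelSet X V c ∩ V ⁻¹' Iic c₀ := by
      ext y
      exact ⟨fun h => ⟨hSΩ h, h.2⟩, fun h => ⟨h.1.1, h.2⟩⟩
    rw [this]
    exact hcpt.of_isClosed_subset (hVΩ.preimage_isClosed_of_isClosed hcpt.isClosed isClosed_Iic)
      inter_subset_left
  -- `V` is continuous only on `X`, so `{V < c'}` is the trace on `X` of an open set, which contains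
  -- a uniform thickening of the compact `S`.
  have hthick : ∀ c', c₀ < c' → ∃ η > 0, ∀ y ∈ X, Metric.infDist y S < η → V y < c' := by
    intro c' hc'
    obtain ⟨U, hU, hUX⟩ := _root_.continuousOn_iff'.1 hV (Iio c') isOpen_Iio
    have hSU : S ⊆ U := fun y hy =>
      (hUX.subset ⟨lt_of_le_of_lt hy.2 hc', hy.1⟩).1
    obtain ⟨η, hη, hηU⟩ := hScpt.exists_thickening_subset_open hU hSU
    exact ⟨η, hη, fun y hy hyS =>
      (hUX.superset ⟨hηU ((Metric.mem_thickening_iff_infDist_lt hne).2 hyS), hy⟩).1⟩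
  -- On the compact part of the larger sublevel set at distance at least `ε` from `S`, the minimum
  -- of `V` exceeds `c₀`; any level strictly between works.
  have hshrink : ∀ ε > 0, ∃ c', c₀ < c' ∧ c' ≤ c ∧
      ∀ y ∈ sublevelSet X V c', Metric.infDist y S < ε := by
    intro ε hε
    set K := sublevelSet X V c ∩ {y | ε ≤ Metric.infDist y S}
    have hK : IsCompact K :=
      hcpt.inter_right (isClosed_le continuous_const (Metric.continuous_infDist_pt S))
    rcases K.eq_empty_or_nonempty with hKe | hKne
    · refine ⟨c, hlt, le_rfl, fun y hy => ?_⟩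
      by_contra! h
      exact (hKe.subset ⟨hy, h⟩).elim
    · obtain ⟨z, hz, hzmin⟩ := hK.exists_isMinOn hKne (hVΩ.mono inter_subset_left)
      have hzc : c₀ < V z := by
        by_contra! h
        have h1 : z ∈ S := ⟨hz.1.1, h⟩
        have h2 : ε ≤ Metric.infDist z S := hz.2
        rw [Metric.infDist_zero_of_mem h1] at h2
        exact hε.not_ge h2
      obtain ⟨c', h1, h2⟩ := exists_between hzc
      refine ⟨c', h1, h2.le.trans hz.1.2, fun y hy => ?_⟩
      by_contra! h
      have h3 : V z ≤ V y := hzmin ⟨⟨hy.1, hy.2.trans (h2.le.trans hz.1.2)⟩, h⟩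
      exact absurd (h3.trans hy.2) h2.not_ge
  refine ⟨⟨hne, hSΩ, ?_, ?_, ?_⟩, fun _ => ?_⟩
  · intro J x hx hx0 t ht
    -- `S` is the intersection of the invariant sublevel sets just above `c₀`.
    refine ⟨hx.mapsTo ht, le_of_forall_gt_imp_ge_of_dense fun c' hc' => ?_⟩
    have hm : c₀ < min c' c := lt_min hc' hlt
    exact ((hinv _ hm (min_le_right _ _) J x hx (sublevelSet_mono hm.le hx0) t ht).2).trans
      (min_le_left _ _)
  · intro ε hε
    obtain ⟨c', h1, h2, h3⟩ := hshrink ε hε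
    obtain ⟨η, hη, hη'⟩ := hthick c' h1
    exact ⟨η, hη, fun J x hx hx0 hd t ht =>
      h3 _ (hinv c' h1 h2 J x hx ⟨hx0.1, (hη' _ hx0.1 hd).le⟩ t ht)⟩
  · intro x hx hx0
    rw [tendsto_order]
    refine ⟨fun a ha => Eventually.of_forall fun t => ha.trans_le Metric.infDist_nonneg,
      fun ε hε => ?_⟩
    obtain ⟨c', h1, h2, h3⟩ := hshrink ε hε
    obtain ⟨q, hq, hqD⟩ := hdecay c' h1 h2
    have hT : ∀ t, (V (x 0) - c') / q < t → 0 ≤ t → V (x t) ≤ c' := by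
      intro t ht ht0
      by_contra! hcon
      have hsub : Icc 0 t ⊆ Ici (0 : ℝ) := fun s hs => hs.1
      have hge : ∀ s ∈ Icc 0 t, c' ≤ V (x s) := by
        intro s hs
        by_contra! hs'
        -- The system is autonomous, so invariance applies from time `s` on: once below `c'`, the
        -- solution stays below.
        have hshift : IsSolutionOn X F (Ici 0) (fun r => x (r + s)) := by
          refine ⟨mem_Ici.2 le_rfl, subset_rfl, ordConnected_Ici,
            fun r hr => hx.mapsTo (add_nonneg hr hs.1), fun r hr => ?_⟩
          have h4 := (hx.integralCurve (r + s) (add_nonneg hr hs.1)).scomp_of_eq r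
            (((hasDerivAt_id r).add_const s).hasDerivWithinAt (s := Ici 0))
            (fun r' hr' => add_nonneg hr' hs.1) rfl
          simpa [Function.comp_def] using h4
        have h5 := hinv c' h1 h2 _ _ hshift
          ⟨by simpa using hx.mapsTo (hsub hs), by simpa using hs'.le⟩ (t - s)
          (mem_Ici.2 (sub_nonneg.2 hs.2))
        rw [sub_add_cancel] at h5
        exact absurd h5.2 hcon.not_ge
      have h6 := le_sub_mul_of_deriv_le (q := q) ht0
        (fun s hs => (hD _ x hx s (hsub hs)).mono hsub)
        (fun s hs => hqD _ (hx.mapsTo (hsub hs)) (hge s hs)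
          (hinvc _ x hx hx0 s (hsub hs)).2)
      rw [div_lt_iff₀ hq] at ht
      nlinarith
    filter_upwards [eventually_gt_atTop ((V (x 0) - c') / q), eventually_ge_atTop 0] with t ht ht0
    exact h3 _ ⟨hx.mapsTo ht0, hT t ht ht0⟩
  · obtain ⟨η, hη, hη'⟩ := hthick c hlt
    exact ⟨η, hη, fun y hy =>
      ⟨hy.2, (hη' y hy.2 ((Metric.mem_thickening_iff_infDist_lt hne).1 hy.1)).le⟩⟩

end Lyapunov

/-! ### The closed-loop system -/

namespace UncertainSystem

variable {n m : ℕ} {sys : UncertainSystem n m} {V : Vec n → ℝ} {gradV : Vec n → Vec n}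

/-- The estimators cancel between the two terms, and the adjoint moves the actuation error from the
input onto the gradient. -/
theorem inner_closedLoop (ahat : Vec n → Vec m) (bhat : Vec n → ℝ) (k : Vec n → Vec m)
    (x : Vec n) :
    ⟪gradV x, sys.closedLoop k x⟫ =
      sys.estDeriv gradV ahat bhat x (k x) + sys.projDist gradV ahat bhat k x := by
  simp only [closedLoop, estDeriv, nominalDeriv, projDist, resA, resB, inner_add_right,
    inner_add_left, inner_sub_left, ContinuousLinearMap.adjoint_inner_left]
  simp only [real_inner_comm (gradV x)]
  ring

theorem IsC1With.isOrbitalDeriv (hV : sys.IsC1With V gradV) (F : Vec n → Vec n) :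
    IsOrbitalDeriv sys.X F V (fun y => ⟪gradV y, F y⟫) := by
  intro J x hx t ht
  have h := (hV.hasGradient (x t) (hx.mapsTo ht)).hasFDerivWithinAt.comp_hasDerivWithinAt t
    (hx.integralCurve t ht) hx.mapsTo
  simpa [Function.comp_def] using h

theorem IsC1With.continuousOn_self (hV : sys.IsC1With V gradV) : ContinuousOn V sys.X :=
  fun x hx => (hV.hasGradient x hx).hasFDerivWithinAt.continuousWithinAt

/-- The true residuals belong to `Δ x`; boundedness of `Δ x` is what makes the real `sSup` an actual
upper bound. -/
theorem projDist_le_worstCase {ahat : Vec n → Vec m} {bhat : Vec n → ℝ}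
    {Δ : Vec n → Set (Vec m × ℝ)} (hΔ : sys.IsUncertaintyFunction gradV ahat bhat Δ)
    (k : Vec n → Vec m) {x : Vec n} (hx : x ∈ sys.X) :
    sys.projDist gradV ahat bhat k x ≤ worstCase (Δ x) (k x) := by
  obtain ⟨hb, hmem⟩ := hΔ x hx
  refine le_csSup ?_ ⟨_, hmem, rfl⟩
  obtain ⟨M, hM⟩ := hb.exists_norm_le
  refine ⟨M * ‖k x‖ + M, ?_⟩
  rintro _ ⟨p, hp, rfl⟩
  have h1 := hM p hp
  exact add_le_add ((real_inner_le_norm _ _).trans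
    (mul_le_mul_of_nonneg_right ((norm_fst_le p).trans h1) (norm_nonneg _)))
    ((Real.le_norm_self _).trans ((norm_snd_le p).trans h1))

end UncertainSystem

/-- Projection to state stability from a dissipation inequality on an invariant set. -/
theorem isPSSOn_of_dissipation {n : ℕ} {X : Set (Vec n)} {F : Vec n → Vec n} {V D δ : Vec n → ℝ}
    {Ω : Set (Vec n)} {αl αu α : ℝ≥0 → ℝ≥0} (hD : IsOrbitalDeriv X F V D)
    (hαl : ClassKInf αl) (hαu : ClassKInf αu) (hα : ClassKInf α)
    (hl : ∀ x ∈ Ω, (αl ‖x‖₊ : ℝ) ≤ V x) (hu : ∀ x ∈ Ω, V x ≤ αu ‖x‖₊)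
    (hdiss : ∀ x ∈ Ω, D x ≤ -(α ‖x‖₊ : ℝ) + δ x) (hinv : IsFwdInvariant X F Ω) :
    IsPSSOn X F δ Ω := by
  have hρ : ClassKInf (fun r => α (kInv αu r)) := hα.comp hαu.kInv
  have h2 : ClassKInf (fun r : ℝ≥0 => 2 * r) :=
    ⟨by fun_prop, fun a b h => mul_lt_mul_of_pos_left h two_pos, by simp,
      tendsto_id.const_mul_atTop two_pos⟩
  -- `β(r, t) = kInv αl (decayBound ρ (αu r) t)` and `γ(s) = kInv αl (kInv ρ (2 * s))`, matching the
  -- two alternatives of `le_decayBound_or_le`.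
  refine ⟨hinv, _, _, (classKLInf_decayBound hρ).comp hαl.kInv hαu,
    hαl.kInv.comp (hρ.kInv.comp h2), ?_⟩
  intro J x hx hx0 hbdd t ht
  set d := sSup ((fun τ => ‖δ (x τ)‖₊) '' J)
  have hΩ := hinv J x hx hx0
  have ht0 : 0 ≤ t := hx.nonneg ht
  have hsub := hx.Icc_subset ht
  have hVnn : ∀ s ∈ J, ((V (x s)).toNNReal : ℝ) = V (x s) := fun s hs =>
    Real.coe_toNNReal _ ((NNReal.coe_nonneg _).trans (hl _ (hΩ s hs)))
  have hVu : ∀ s ∈ J, (V (x s)).toNNReal ≤ αu ‖x s‖₊ := fun s hs =>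
    Real.toNNReal_le_iff_le_coe.2 (hu _ (hΩ s hs))
  have hxt : ‖x t‖₊ ≤ kInv αl (V (x t)).toNNReal := by
    rw [hαl.le_kInv_iff, ← NNReal.coe_le_coe, hVnn t ht]
    exact hl _ (hΩ t ht)
  have key := le_decayBound_or_le hρ (w := fun s => (V (x s)).toNNReal) (w' := fun s => D (x s))
    (d := d) (t := t.toNNReal)
    (by
      rw [Real.coe_toNNReal t ht0]
      exact fun s hs => ((hD J x hx s (hsub hs)).mono hsub).congr
        (fun r hr => hVnn r (hsub hr)) (hVnn s (hsub hs)))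
    (by
      rw [Real.coe_toNNReal t ht0]
      intro s hs
      have h3 := hdiss _ (hΩ s (hsub hs))
      have h4 : δ (x s) ≤ d := (Real.le_norm_self _).trans
        (NNReal.coe_le_coe.2 (le_csSup hbdd ⟨s, hsub hs, rfl⟩))
      have h5 : α (kInv αu (V (x s)).toNNReal) ≤ α ‖x s‖₊ :=
        hα.strictMono.monotone (hαu.kInv_le_iff.2 (hVu s (hsub hs)))
      have h6 := NNReal.coe_le_coe.2 h5
      linarith)
  simp only [Real.coe_toNNReal t ht0] at key
  rcases key with h | h
  · refine (hxt.trans (hαl.kInv.strictMono.monotone (h.trans ?_))).trans le_self_add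
    exact ((classKLInf_decayBound hρ).kInf _).strictMono.monotone (hVu 0 hx.zero_mem)
  · exact (hxt.trans (hαl.kInv.strictMono.monotone (hρ.le_kInv_iff.2 h))).trans le_add_self

theorem corollary2 {n m : ℕ} (sys : UncertainSystem n m)
    (V : Vec n → ℝ) (gradV : Vec n → Vec n)
    (ahat : Vec n → Vec m) (bhat : Vec n → ℝ)
    (hahat : ContinuousOn ahat sys.X) (hbhat : ContinuousOn bhat sys.X)
    (C : Set (Vec n)) (hCX : C ⊆ sys.X) (hC0 : 0 ∈ C)
    (αl αu α αp αq : ℝ≥0 → ℝ≥0)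
    (hV : sys.IsCLFOn V gradV αl αu α C)
    (hαp : ClassKInf αp) (hαq : ClassKInf αq) (hα : αp + αq = α)
    (k : Vec n → Vec m) (hkU : ∀ x ∈ sys.X, k x ∈ sys.U)
    (hk : ∀ x ∈ C, k x ∈ sys.admissible gradV ahat bhat α x)
    (Δ : Vec n → Set (Vec m × ℝ)) (hΔ : sys.IsUncertaintyFunction gradV ahat bhat Δ)
    (E : Set (Vec n)) (hEX : E ⊆ sys.X) (μ : ℝ≥0)
    (hμ : ∀ x ∈ E, worstCase (Δ x) (k x) ≤ μ)
    (Ω : Set (Vec n)) (hΩ : ∃ c : ℝ, 0 < c ∧ Ω = sublevelSet sys.X V c)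
    (hBΩ : Metric.ball 0 (kInv αq μ) ⊆ Ω) (hΩCE : Ω ⊆ C ∩ E) :
    IsPSSOn sys.X (sys.closedLoop k) (sys.projDist gradV ahat bhat k) Ω ∧
    ∃ S : Set (Vec n),
      IsLeast {S' | ∃ c : ℝ, 0 ≤ c ∧ S' = sublevelSet sys.X V c ∧
        Metric.ball 0 (kInv αq μ) ⊆ S'} S ∧
      (IsClosed Ω →
        IsAsymptoticallyStableOn sys.X (sys.closedLoop k) Ω S ∧
        (S ≠ Ω → ∃ η > 0, Metric.thickening η S ∩ sys.X ⊆ Ω)) := by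
  obtain ⟨c, hc, rfl⟩ := hΩ
  set Ω := sublevelSet sys.X V c
  set B : Set (Vec n) := Metric.ball 0 (kInv αq μ)
  set D : Vec n → ℝ := fun y => ⟪gradV y, sys.closedLoop k y⟫
  have hD : IsOrbitalDeriv sys.X (sys.closedLoop k) V D := hV.c1.isOrbitalDeriv _
  have hV0 : V 0 = 0 := by
    refine le_antisymm ?_ (hV.c1.nonneg 0 sys.zero_mem)
    simpa [hV.upper_kInf.map_zero] using hV.upper 0 hC0
  have hdiss : ∀ y ∈ Ω, D y ≤ -(α ‖y‖₊ : ℝ) + sys.projDist gradV ahat bhat k y := fun y hy => by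
    have h1 := (hk y (hΩCE hy).1).2
    have h2 := UncertainSystem.inner_closedLoop (sys := sys) (gradV := gradV) ahat bhat k y
    show ⟪gradV y, sys.closedLoop k y⟫ ≤ _
    linarith
  have hdecay : ∀ y ∈ Ω, y ∉ B → D y ≤ -(αp ‖y‖₊ : ℝ) := fun y hy hyB => by
    have h1 := hdiss y hy
    have h2 := (UncertainSystem.projDist_le_worstCase hΔ k hy.1).trans (hμ y (hΩCE hy).2)
    have h3 : μ ≤ αq ‖y‖₊ := by
      rw [← hαq.kInv_le_iff, ← NNReal.coe_le_coe, coe_nnnorm]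
      simpa [B] using hyB
    have h4 : (μ : ℝ) ≤ αq ‖y‖₊ := NNReal.coe_le_coe.2 h3
    rw [← hα, Pi.add_apply, NNReal.coe_add] at h1
    linarith
  -- `V y ≥ c'` keeps `y` away from the origin, `‖y‖ ≥ kInv αu c'`, so the decay is uniform.
  have hrate : ∀ c' : ℝ, ∀ y ∈ Ω, y ∉ B → c' ≤ V y →
      D y ≤ -(αp (kInv αu c'.toNNReal) : ℝ) := by
    intro c' y hy hyB hyc
    refine (hdecay y hy hyB).trans (neg_le_neg (NNReal.coe_le_coe.2
      (hαp.strictMono.monotone (hV.upper_kInf.kInv_le_iff.2 ?_))))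
    exact Real.toNNReal_le_iff_le_coe.2 (hyc.trans (hV.upper y (hΩCE hy).1))
  have hrate_pos : ∀ c' : ℝ, 0 < c' → 0 < (αp (kInv αu c'.toNNReal) : ℝ) := fun c' hc' =>
    NNReal.coe_pos.2 (hαp.pos (hV.upper_kInf.kInv.pos (Real.toNNReal_pos.2 hc')))
  have hinv : ∀ c', 0 < c' → c' ≤ c → B ⊆ sublevelSet sys.X V c' →
      IsFwdInvariant sys.X (sys.closedLoop k) (sublevelSet sys.X V c') := by
    intro c' hc' hcc hBc'
    refine isFwdInvariant_sublevelSet hD Metric.isOpen_ball hBc' fun y hy hyc hyB => ?_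
    exact (hrate c' y ⟨hy, hyc.trans_le hcc⟩ hyB hyc.ge).trans_lt
      (neg_neg_iff_pos.2 (hrate_pos c' hc'))
  have hinvΩ := hinv c hc le_rfl hBΩ
  refine ⟨isPSSOn_of_dissipation hD hV.lower_kInf hV.upper_kInf hV.decay_kInf
    (fun x hx => hV.lower x (hΩCE hx).1) (fun x hx => hV.upper x (hΩCE hx).1) hdiss hinvΩ, ?_⟩
  -- `B` is empty when `μ = 0`; inserting `0` then gives the level `0`, the least one allowed.
  have hbdd : BddAbove (insert 0 (V '' B)) :=
    ⟨c, forall_mem_insert.2 ⟨hc.le, forall_mem_image.2 fun y hy => (hBΩ hy).2⟩⟩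
  set c₀ := sSup (insert 0 (V '' B))
  have hc₀ : 0 ≤ c₀ := le_csSup hbdd (mem_insert _ _)
  have hBc₀ : B ⊆ sublevelSet sys.X V c₀ := fun y hy =>
    ⟨(hBΩ hy).1, le_csSup hbdd (mem_insert_of_mem _ (mem_image_of_mem V hy))⟩
  have hc₀le : ∀ c', 0 ≤ c' → B ⊆ sublevelSet sys.X V c' → c₀ ≤ c' := fun c' hc' h =>
    csSup_le (insert_nonempty _ _)
      (forall_mem_insert.2 ⟨hc', forall_mem_image.2 fun y hy => (h hy).2⟩)
  refine ⟨sublevelSet sys.X V c₀, ⟨⟨c₀, hc₀, rfl, hBc₀⟩, ?_⟩, fun hclosed => ?_⟩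
  · rintro _ ⟨c', hc', rfl, h⟩
    exact sublevelSet_mono (hc₀le c' hc' h)
  · have hcpt : IsCompact Ω := by
      refine Metric.isCompact_of_isClosed_isBounded hclosed
        (isBounded_iff_forall_norm_le.2 ⟨kInv αl c.toNNReal, fun y hy => ?_⟩)
      rw [← coe_nnnorm, NNReal.coe_le_coe, hV.lower_kInf.le_kInv_iff, ← NNReal.coe_le_coe,
        Real.coe_toNNReal c hc.le]
      exact (hV.lower y (hΩCE hy).1).trans hy.2
    refine isAsymptoticallyStableOn_sublevelSet hV.c1.continuousOn_self hD
      (hc₀le c hc.le hBΩ) hcpt ⟨0, sys.zero_mem, hV0.trans_le hc₀⟩ hinvΩ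
      (fun c' h1 h2 => hinv c' (hc₀.trans_lt h1) h2 (hBc₀.trans (sublevelSet_mono h1.le)))
      (fun c' h1 h2 => ⟨_, hrate_pos c' (hc₀.trans_lt h1), fun y hy hy1 hy2 =>
        hrate c' y ⟨hy, hy2⟩
          (fun hyB => ?_) hy1⟩)
    -- On `B` the value of `V` is at most `c₀`, below the shell.
    exact absurd (hBc₀ hyB).2 (h1.trans_le hy1).not_ge

end
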